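/- A convex polyhedron is the convex hull of a finite set of points of $\mathbb R^3$ that has nonempty interior; its vertices, edges and faces are its faces of dimension $0$, $1$ and $2$. Two convex polyhedra $\Gamma$ and $\Gamma^\perp$ are dual if there are a bijection $\varphi$ from the vertices of $\Gamma$ to the faces of $\Gamma^\perp$ and a bijection $\psi$ from the faces of $\Gamma$ to the vertices of $\Gamma^\perp$ such that a vertex $v$ lies on a face $F$ of $\Gamma$ if and only if the vertex $\psi(F)$ lies on the face $\varphi(v)$ of $\Gamma^\perp$. For a convex polyhedron $\Gamma$ with $e$ edges, labelled arbitrarily by $1,\dots,e$, the code $\mathcal C(\Gamma)\subseteq\mathbb F_2^e$ generated by $\Gamma$ is the set of all $c\in\mathbb F_2^e$ such that, for every vertex $v$ of $\Gamma$, the entries of $c$ at the edges containing $v$ sum to $0$. The dual code of $\mathcal C\subseteq\mathbb F_2^e$ is $\mathcal C^\perp=\{y\in\mathbb F_2^e : \sum_i x_iy_i=0 \text{ for all } x\in\mathcal C\}$, and two binary codes are isomorphic if one is obtained from the other by a bijective relabelling of the coordinates (in particular they have the same length). Corollary. Let $\Gamma$ and $\Gamma^\perp$ be dual convex polyhedra,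 with arbitrary labellings of their edges. Then the dual code $\mathcal C(\Gamma)^\perp$ of the code generated by $\Gamma$ is isomorphic to the code $\mathcal C(\Gamma^\perp)$ generated by $\Gamma^\perp$. -/

import Mathlib

/-- Euclidean three-dimensional space. -/
abbrev Space3 : Type := EuclideanSpace ℝ (Fin 3)

/-- A convex polyhedron: the convex hull of finitely many points of three-dimensional space
which has an interior point (so it is bounded and is not contained in a plane). -/
structure ConvexPolyhedron where
  carrier : Set Space3
  exists_hull : ∃ S : Set Space3, S.Finite ∧ carrier = convexHull ℝ S
  nonempty_interior : (interior carrier).Nonempty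

namespace ConvexPolyhedron

/-- `F` is a `k`-dimensional face of `P`: a nonempty set on which some linear functional attains
its maximum over `P`, whose affine span has dimension `k`. -/
def IsFace (P : ConvexPolyhedron) (k : ℕ) (F : Set Space3) : Prop :=
  F.Nonempty ∧ IsExposed ℝ P.carrier F ∧ Module.finrank ℝ (vectorSpan ℝ F) = k

/-- The vertices of `P`, each regarded as a one-point set. -/
def Vertex (P : ConvexPolyhedron) : Type := {F : Set Space3 // P.IsFace 0 F}

/-- The edges of `P`. -/
def Edge (P : ConvexPolyhedron) : Type := {F : Set Space3 // P.IsFace 1 F}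

/-- The two-dimensional faces of `P` (the faces of a polyhedron in the everyday sense). -/
def Facet (P : ConvexPolyhedron) : Type := {F : Set Space3 // P.IsFace 2 F}

/-- `P` and `Q` are dual: the vertices of each correspond bijectively to the faces of the other,
and a vertex of `P` lies on a face of `P` exactly when the corresponding face of `Q` contains the
corresponding vertex of `Q`. -/
def IsDual (P Q : ConvexPolyhedron) : Prop :=
  ∃ (φ : P.Vertex ≃ Q.Facet) (ψ : P.Facet ≃ Q.Vertex),
    ∀ (v : P.Vertex) (F : P.Facet), v.1 ⊆ F.1 ↔ (ψ F).1 ⊆ (φ v).1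

open Classical in
/-- The code generated by `P`, for a labelling `l` of its edges: all binary words for which the
entries at the edges meeting at any one vertex sum to zero. -/
def code (P : ConvexPolyhedron) {n : ℕ} (l : Fin n ≃ P.Edge) :
    Submodule (ZMod 2) (Fin n → ZMod 2) where
  carrier := {c | ∀ v : P.Vertex, ∑ i with v.1 ⊆ (l i).1, c i = 0}
  zero_mem' := by intro v; simp
  add_mem' := by
    intro a b ha hb v
    simp [Finset.sum_add_distrib, ha v, hb v]
  smul_mem' := by
    intro r a ha v
    simp [← Finset.mul_sum, ha v]

/-- Every polyhedron has finitely many edges, hence a labelling of them. -/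
theorem exists_labelling (P : ConvexPolyhedron) : ∃ n : ℕ, Nonempty (Fin n ≃ P.Edge) := by
  obtain ⟨S, hS, hP⟩ := P.exists_hull
  have hc : IsCompact P.carrier := hP ▸ hS.isCompact_convexHull (𝕜 := ℝ)
  have hconv : Convex ℝ P.carrier := hP ▸ convex_convexHull ℝ S
  have key : ∀ F : P.Edge, F.1 = convexHull ℝ (F.1 ∩ S) := by
    intro F
    have hF := F.2.2.1
    have hFc : IsCompact F.1 := hF.isCompact hc
    have hFconv : Convex ℝ F.1 := hF.convex hconv
    have hext : F.1.extremePoints ℝ ⊆ F.1 ∩ S := by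
      intro x hx
      refine ⟨hx.1, ?_⟩
      have h1 : x ∈ P.carrier.extremePoints ℝ := hF.isExtreme.extremePoints_subset_extremePoints hx
      rw [hP] at h1
      exact extremePoints_convexHull_subset h1
    refine Set.Subset.antisymm ?_ (convexHull_min Set.inter_subset_left hFconv)
    rw [← closure_convexHull_extremePoints hFc hFconv]
    have hfin : (F.1 ∩ S).Finite := hS.subset Set.inter_subset_right
    refine closure_minimal ?_ ?_
    · rw [closure_convexHull_extremePoints hFc hFconv]
      exact convexHull_mono hext
    · rw [closure_convexHull_extremePoints hFc hFconv]
      exact (hfin.isCompact_convexHull (𝕜 := ℝ)).isClosed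
  have : Finite (Set.powerset S) := hS.finite_subsets
  have : Finite P.Edge := by
    refine Finite.of_injective
      (fun F : P.Edge => (⟨F.1 ∩ S, Set.inter_subset_right⟩ : Set.powerset S)) ?_
    intro F G h
    have h' : F.1 ∩ S = G.1 ∩ S := congrArg Subtype.val h
    apply Subtype.ext
    rw [key F, key G, h']
  obtain ⟨n, ⟨e⟩⟩ := Finite.exists_equiv_fin P.Edge
  exact ⟨n, ⟨e.symm⟩⟩

end ConvexPolyhedron

/-- The dual code: all words orthogonal to every codeword for the standard dot product. -/
def dualCode {n : ℕ} (C : Submodule (ZMod 2) (Fin n → ZMod 2)) :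
    Submodule (ZMod 2) (Fin n → ZMod 2) where
  carrier := {y | ∀ x ∈ C, x ⬝ᵥ y = 0}
  zero_mem' := by intro x _; simp
  add_mem' := by
    intro a b ha hb x hx
    rw [dotProduct_add, ha x hx, hb x hx, add_zero]
  smul_mem' := by
    intro r a ha x hx
    rw [dotProduct_smul, ha x hx, smul_zero]

/-- Two binary codes are isomorphic if one is obtained from the other by relabelling the
coordinates. -/
def CodeIsomorphic {n m : ℕ} (C : Submodule (ZMod 2) (Fin n → ZMod 2))
    (D : Submodule (ZMod 2) (Fin m → ZMod 2)) : Prop :=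
  ∃ σ : Fin n ≃ Fin m, ∀ x : Fin m → ZMod 2, x ∈ D ↔ x ∘ σ ∈ C

open Module (finrank)

/-!
The dual code consists of the words orthogonal to the edge set of every facet. One inclusion holds
because a facet has exactly two edges at each of its vertices. The other is the vanishing of the
first cohomology of the boundary sphere modulo two: a word orthogonal to all facets is a coboundary.
To see this, sweep the vertices downward along a functional that separates them. When `v` is reached
and the word has been made to vanish on the edges above `v`, orthogonality to a facet with lowest
vertex `v` forces equal values on its two edges at `v`. Such facets link all the ascending edges at
`v`: as in the simplex method, from any ascending edge one can pivot inside a facet to a steeper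
one, and a suitable projective normalisation makes any prescribed ascending edge the steepest. So
changing the word by the coboundary of a multiple of `v` makes it vanish on all these edges. Finally
an edge joins two vertices and lies in two facets, so a duality, which exchanges vertices with
facets, carries edges to edges and facet orthogonality to vertex orthogonality.
-/

section ExposedFaces

variable {E : Type*} [NormedAddCommGroup E] [NormedSpace ℝ E] {K F G : Set E} {f g : StrongDual ℝ E}
  {v : E}

theorem exists_isMaxOn_of_isExposed (hF : IsExposed ℝ K F) (hv : v ∈ F) :
    ∃ f : StrongDual ℝ E, IsMaxOn f K v ∧ ∀ x ∈ K, x ∈ F ↔ f x = f v := by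
  obtain ⟨f, rfl⟩ := hF ⟨v, hv⟩
  exact ⟨f, hv.2, fun x hx =>
    ⟨fun h => (hv.2 x hx).antisymm (h.2 v hv.1), fun h => ⟨hx, fun y hy => h ▸ hv.2 y hy⟩⟩⟩

theorem isExposed_of_isMaxOn (hf : IsMaxOn f K v) : IsExposed ℝ K {x ∈ K | f x = f v} := by
  rintro ⟨w, hw, hwv⟩
  refine ⟨f, Set.ext fun x => and_congr_right fun hx => ⟨fun h y hy => h ▸ hf hy, fun h => ?_⟩⟩
  exact (hf hx).antisymm (hwv ▸ h w hw)

theorem map_eq_zero_of_mem_vectorSpan (hf : ∀ x ∈ F, f x = f v) {u : E}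
    (hu : u ∈ vectorSpan ℝ F) : f u = 0 := by
  have h : vectorSpan ℝ F ≤ LinearMap.ker f.toLinearMap := by
    refine Submodule.span_le.2 ?_
    rintro _ ⟨x, hx, y, hy, rfl⟩
    simp [hf x hx, hf y hy]
  exact h hu

variable [FiniteDimensional ℝ E]

theorem finrank_vectorSpan_pos_iff : 0 < finrank ℝ (vectorSpan ℝ F) ↔ F.Nontrivial := by
  rw [Nat.pos_iff_ne_zero, ne_eq, Submodule.finrank_eq_zero, vectorSpan_eq_bot_iff_subsingleton,
    Set.not_subsingleton_iff]

theorem finrank_vectorSpan_lt (hFG : F ⊆ G) (hf : ∀ x ∈ F, f x = f v) (hv : v ∈ G) {x : E}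
    (hx : x ∈ G) (hfx : f x ≠ f v) : finrank ℝ (vectorSpan ℝ F) < finrank ℝ (vectorSpan ℝ G) := by
  refine Submodule.finrank_lt_finrank_of_lt (lt_of_le_of_ne (vectorSpan_mono ℝ hFG) fun h => hfx ?_)
  have hxv : x - v ∈ vectorSpan ℝ F := h ▸ vsub_mem_vectorSpan ℝ hx hv
  simpa [sub_eq_zero] using map_eq_zero_of_mem_vectorSpan hf hxv

theorem eq_of_subset_of_finrank_le (hF : IsExposed ℝ K F) (hne : F.Nonempty) (hFG : F ⊆ G)
    (hGK : G ⊆ K) (h : finrank ℝ (vectorSpan ℝ G) ≤ finrank ℝ (vectorSpan ℝ F)) : F = G := by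
  obtain ⟨v, hv⟩ := hne
  obtain ⟨f, -, hf⟩ := exists_isMaxOn_of_isExposed hF hv
  refine hFG.antisymm fun x hx => (hf x (hGK hx)).2 ?_
  by_contra hfx
  exact h.not_gt
    (finrank_vectorSpan_lt hFG (fun y hy => (hf y (hGK (hFG hy))).1 hy) (hFG hv) hx hfx)

end ExposedFaces

section Polytopes

variable {E : Type*} [NormedAddCommGroup E] [NormedSpace ℝ E] {K F G S : Set E}
  {f g : StrongDual ℝ E} {v : E}

/-- A convex polytope of any dimension. Faces of a polyhedron are polytopes in this sense, so that
statements about a face of a polytope apply both to a polyhedron and to its facets. -/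
def IsPolytope (K : Set E) : Prop :=
  ∃ S : Set E, S.Finite ∧ K = convexHull ℝ S

theorem eq_convexHull_inter_of_isExposed (hS : S.Finite) (hF : IsExposed ℝ (convexHull ℝ S) F) :
    F = convexHull ℝ (F ∩ S) := by
  have hcompact : IsCompact F := hF.isCompact (hS.isCompact_convexHull (𝕜 := ℝ))
  have hconvex : Convex ℝ F := hF.convex (convex_convexHull ℝ S)
  have hextreme : F.extremePoints ℝ ⊆ F ∩ S := fun x hx =>
    ⟨hx.1, extremePoints_convexHull_subset (hF.isExtreme.extremePoints_subset_extremePoints hx)⟩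
  refine Set.Subset.antisymm ?_ (convexHull_min Set.inter_subset_left hconvex)
  calc F = closure (convexHull ℝ (F.extremePoints ℝ)) :=
        (closure_convexHull_extremePoints hcompact hconvex).symm
    _ ⊆ closure (convexHull ℝ (F ∩ S)) := closure_mono (convexHull_mono hextreme)
    _ = convexHull ℝ (F ∩ S) :=
        ((hS.subset Set.inter_subset_right).isCompact_convexHull (𝕜 := ℝ)).isClosed.closure_eq

theorem isMaxOn_convexHull (h : IsMaxOn f S v) : IsMaxOn f (convexHull ℝ S) v := fun _ hx =>
  convexHull_min h (convex_halfSpace_le f.toLinearMap.isLinear (f v)) hx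

namespace IsPolytope

theorem isCompact (hK : IsPolytope K) : IsCompact K := by
  obtain ⟨S, hS, rfl⟩ := hK
  exact hS.isCompact_convexHull (𝕜 := ℝ)

theorem convex (hK : IsPolytope K) : Convex ℝ K := by
  obtain ⟨S, -, rfl⟩ := hK
  exact convex_convexHull ℝ S

theorem of_isExposed (hK : IsPolytope K) (hF : IsExposed ℝ K F) : IsPolytope F := by
  obtain ⟨S, hS, rfl⟩ := hK
  exact ⟨F ∩ S, hS.subset Set.inter_subset_right, eq_convexHull_inter_of_isExposed hS hF⟩

theorem finite_setOf_isExposed (hK : IsPolytope K) : {F | IsExposed ℝ K F}.Finite := by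
  obtain ⟨S, hS, rfl⟩ := hK
  refine Set.Finite.of_finite_image (f := fun F => F ∩ S)
    (hS.finite_subsets.subset (Set.image_subset_iff.2 fun F _ => Set.inter_subset_right)) ?_
  intro F hF G hG h
  rw [eq_convexHull_inter_of_isExposed hS hF, eq_convexHull_inter_of_isExposed hS hG]
  exact congrArg (convexHull ℝ) h

theorem exists_isMaxOn_add_smul (hK : IsPolytope K) (hg : IsMaxOn g K v)
    (hf : ∀ x ∈ K, g x = g v → f x ≤ f v) :
    ∃ N : ℝ, 0 ≤ N ∧ IsMaxOn (f + N • g) K v ∧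
      ∀ x ∈ K, (f + N • g) x = (f + N • g) v ↔ f x = f v ∧ g x = g v := by
  obtain ⟨S, hS, rfl⟩ := hK
  have hlarge : ∀ x ∈ S, ∀ᶠ N : ℝ in Filter.atTop, (f + N • g) x ≤ (f + N • g) v := by
    intro x hx
    have hxK := subset_convexHull ℝ S hx
    rcases (isMaxOn_iff.1 hg x hxK).lt_or_eq with h | h
    · filter_upwards [Filter.eventually_ge_atTop ((f x - f v) / (g v - g x))] with N hN
      rw [div_le_iff₀ (sub_pos.2 h)] at hN
      simp only [add_apply, smul_apply, smul_eq_mul]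
      linarith
    · exact .of_forall fun N => by simpa [h] using hf x hxK h
  obtain ⟨N, hN, hN0⟩ :=
    ((hS.eventually_all.2 hlarge).and (Filter.eventually_ge_atTop 0)).exists
  have hmax : ∀ x ∈ convexHull ℝ S, f x + N * g x ≤ f v + N * g v := fun x hx => by
    simpa using isMaxOn_convexHull (f := f + N • g) hN hx
  refine ⟨N + 1, by linarith, fun x hx => ?_,
    fun x hx => ⟨fun h => ?_, fun ⟨h, h'⟩ => by simp [h, h']⟩⟩
  · have := hmax x hx
    have : g x ≤ g v := hg hx
    simp only [Set.mem_ofPred_eq, add_apply, smul_apply, smul_eq_mul]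
    linarith
  · have := hmax x hx
    have : g x ≤ g v := hg hx
    simp only [add_apply, smul_apply, smul_eq_mul] at h
    have hgx : g x = g v := by linarith
    exact ⟨by rw [hgx] at h; linarith, hgx⟩

theorem isExposed_trans (hK : IsPolytope K) (hG : IsExposed ℝ K G) (hF : IsExposed ℝ G F) :
    IsExposed ℝ K F := by
  rintro ⟨v, hv⟩
  have hGK := hG.subset
  obtain ⟨g, hgmax, hg⟩ := exists_isMaxOn_of_isExposed hG (hF.subset hv)
  obtain ⟨f, hfmax, hf⟩ := exists_isMaxOn_of_isExposed hF hv
  obtain ⟨N, -, hmax, hN⟩ := hK.exists_isMaxOn_add_smul hgmax fun x hx h => hfmax ((hg x hx).2 h)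
  suffices h : F = {x ∈ K | (f + N • g) x = (f + N • g) v} by
    exact h ▸ isExposed_of_isMaxOn hmax ⟨v, hGK (hF.subset hv), rfl⟩
  ext x
  refine ⟨fun hx => ?_, fun ⟨hxK, hx⟩ => ?_⟩
  · have hxG := hF.subset hx
    exact ⟨hGK hxG, (hN x (hGK hxG)).2 ⟨(hf x hxG).1 hx, (hg x (hGK hxG)).1 hxG⟩⟩
  · obtain ⟨hfx, hgx⟩ := (hN x hxK).1 hx
    exact (hf x ((hg x hxK).2 hgx)).2 hfx

end IsPolytope

end Polytopes

section Ridges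

variable {E : Type*} [NormedAddCommGroup E] [NormedSpace ℝ E] {K F H : Set E}
  {f₁ f₂ j k m : StrongDual ℝ E} {v a b : E}

/-- Two functionals maximal on the face `F` of `K` through `v`, of which exactly the first is
maximal at `a` and exactly the second is maximal at `b`. When `F` has codimension two in `K`, these
functionals expose the two facets of `K` containing `F`. -/
structure IsRidgePair (K F : Set E) (v : E) (f₁ f₂ : StrongDual ℝ E) (a b : E) : Prop where
  isMaxOn₁ : IsMaxOn f₁ K v
  isMaxOn₂ : IsMaxOn f₂ K v
  const₁ : ∀ x ∈ F, f₁ x = f₁ v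
  const₂ : ∀ x ∈ F, f₂ x = f₂ v
  mem_a : a ∈ K
  mem_b : b ∈ K
  map_a₁ : f₁ a = f₁ v
  map_a₂ : f₂ a < f₂ v
  map_b₁ : f₁ b < f₁ v
  map_b₂ : f₂ b = f₂ v

/-- The face `H` of `K` covers `F` in the face lattice: it contains `F` in codimension one. -/
structure IsCoveringFace (K F H : Set E) : Prop where
  isExposed : IsExposed ℝ K H
  subset : F ⊆ H
  finrank_eq : finrank ℝ (vectorSpan ℝ H) = finrank ℝ (vectorSpan ℝ F) + 1

theorem IsRidgePair.symm (h : IsRidgePair K F v f₁ f₂ a b) : IsRidgePair K F v f₂ f₁ b a :=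
  ⟨h.isMaxOn₂, h.isMaxOn₁, h.const₂, h.const₁, h.mem_b, h.mem_a, h.map_b₂, h.map_b₁, h.map_a₂,
    h.map_a₁⟩

/-- The ratio test of the simplex method: tilt `m` by multiples of `k` until a further point becomes
maximal. -/
theorem IsPolytope.exists_isMaxOn_sub_smul (hK : IsPolytope K) (hk : IsMaxOn k K v)
    (hkF : ∀ x ∈ K, x ∈ F ↔ k x = k v) (hm : ∀ x ∈ F, m x = m v) (hF : ∃ x ∈ K, x ∉ F) :
    ∃ s : ℝ, ∃ a ∈ K, a ∉ F ∧ IsMaxOn (m - s • k) K v ∧ (m - s • k) a = (m - s • k) v := by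
  obtain ⟨S, hS, rfl⟩ := hK
  have hlt : ∀ x ∈ S \ F, k x < k v := fun x hx =>
    have hxK := subset_convexHull ℝ S hx.1
    (isMaxOn_iff.1 hk x hxK).lt_of_ne fun h => hx.2 ((hkF x hxK).2 h)
  have hne : (S \ F).Nonempty := by
    by_contra! hempty
    obtain ⟨x, hx, hxF⟩ := hF
    have hSk : IsMaxOn (-k) S v := fun y hy => by
      have hyF : y ∈ F := by_contra fun h => Set.notMem_empty y (hempty ▸ ⟨hy, h⟩)
      simp [(hkF y (subset_convexHull ℝ S hy)).1 hyF]
    have hle : k v ≤ k x := by simpa using isMaxOn_iff.1 (isMaxOn_convexHull hSk) x hx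
    exact hxF ((hkF x hx).2 ((isMaxOn_iff.1 hk x hx).antisymm hle))
  obtain ⟨a, ha, hmin⟩ :=
    Set.exists_min_image (S \ F) (fun x => (m x - m v) / (k x - k v)) hS.sdiff hne
  refine ⟨(m a - m v) / (k a - k v), a, subset_convexHull ℝ S ha.1, ha.2,
    isMaxOn_convexHull fun x hx => ?_, ?_⟩
  · simp only [Set.mem_ofPred_eq, sub_apply, smul_apply, smul_eq_mul]
    by_cases hxF : x ∈ F
    · simp [hm x hxF, (hkF x (subset_convexHull ℝ S hx)).1 hxF]
    · have := hmin x ⟨hx, hxF⟩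
      rw [le_div_iff_of_neg (sub_neg.2 (hlt x ⟨hx, hxF⟩))] at this
      linarith
  · have := div_mul_cancel₀ (m a - m v) (sub_neg.2 (hlt a ha)).ne
    simp only [sub_apply, smul_apply, smul_eq_mul]
    linarith

theorem add_neg_of_isMaxOn_sub_smul {s t : ℝ} {x y : E} (hs : IsMaxOn (m - s • k) K v)
    (ht : IsMaxOn (-m - t • k) K v) (hx : x ∈ K) (hkx : k x < k v) (hmx : m x = m v) (hy : y ∈ K)
    (hmy : m y ≠ m v) : s + t < 0 := by
  rw [isMaxOn_iff] at hs ht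
  simp only [sub_apply, smul_apply, smul_eq_mul, neg_apply] at hs ht
  by_contra! h
  have hsx := hs x hx
  have htx := ht x hx
  rw [hmx] at hsx htx
  have hs0 : s ≤ 0 := by nlinarith
  have ht0 : t ≤ 0 := by nlinarith
  obtain rfl : s = 0 := by linarith
  obtain rfl : t = 0 := by linarith
  exact hmy (le_antisymm (by linarith [hs y hy]) (by linarith [ht y hy]))

variable [FiniteDimensional ℝ E]

theorem exists_strongDual_of_finrank_eq_add_two {x₀ : E}
    (hdim : finrank ℝ (vectorSpan ℝ K) = finrank ℝ (vectorSpan ℝ F) + 2) (hv : v ∈ F) :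
    ∃ m : StrongDual ℝ E, (∀ x ∈ F, m x = m v) ∧ m x₀ = m v ∧ ∃ y ∈ K, m y ≠ m v := by
  let U : Submodule ℝ E := vectorSpan ℝ F ⊔ Submodule.span ℝ {x₀ - v}
  obtain ⟨u, hu, huU⟩ : ∃ u ∈ vectorSpan ℝ K, u ∉ U := by
    by_contra! h
    have h₁ : finrank ℝ (vectorSpan ℝ K) ≤ finrank ℝ U := Submodule.finrank_mono h
    have h₂ : finrank ℝ U ≤ _ := Submodule.finrank_add_le_finrank_add_finrank (vectorSpan ℝ F)
      (Submodule.span ℝ {x₀ - v})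
    have h₃ := finrank_span_le_card (R := ℝ) ({x₀ - v} : Set E)
    simp only [Set.toFinset_singleton, Finset.card_singleton] at h₃
    omega
  obtain ⟨m, hmu, hUm⟩ := Submodule.exists_le_ker_of_notMem huU
  have hmF : ∀ x ∈ F, m x = m v := fun x hx => sub_eq_zero.1 <| by
    rw [← map_sub]
    exact hUm (Submodule.mem_sup_left (vsub_mem_vectorSpan ℝ hx hv))
  have hmx₀ : m x₀ = m v := sub_eq_zero.1 <| by
    rw [← map_sub]
    exact hUm (Submodule.mem_sup_right (Submodule.mem_span_singleton_self _))
  refine ⟨m.toContinuousLinearMap, hmF, hmx₀, ?_⟩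
  by_contra! hmK
  exact hmu (map_eq_zero_of_mem_vectorSpan hmK hu)

theorem exists_isRidgePair (hK : IsPolytope K) (hF : IsExposed ℝ K F) (hv : v ∈ F)
    (hdim : finrank ℝ (vectorSpan ℝ K) = finrank ℝ (vectorSpan ℝ F) + 2) :
    ∃ f₁ f₂ a b, IsRidgePair K F v f₁ f₂ a b := by
  obtain ⟨k, hk, hkF⟩ := exists_isMaxOn_of_isExposed hF hv
  obtain ⟨x₀, hx₀, hx₀F⟩ : ∃ x ∈ K, x ∉ F := by
    by_contra! h
    rw [hF.subset.antisymm h] at hdim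
    omega
  obtain ⟨m, hm, hmx₀, y, hy, hmy⟩ :=
    exists_strongDual_of_finrank_eq_add_two (x₀ := x₀) hdim hv
  obtain ⟨s, a, ha, haF, hs, hsa⟩ := hK.exists_isMaxOn_sub_smul hk hkF hm ⟨x₀, hx₀, hx₀F⟩
  obtain ⟨t, b, hb, hbF, ht, htb⟩ :=
    hK.exists_isMaxOn_sub_smul (m := -m) hk hkF (by simpa using hm) ⟨x₀, hx₀, hx₀F⟩
  have hlt : ∀ x ∈ K, x ∉ F → k x < k v := fun x hx hxF =>
    (isMaxOn_iff.1 hk x hx).lt_of_ne fun h => hxF ((hkF x hx).2 h)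
  have hst : s + t < 0 := add_neg_of_isMaxOn_sub_smul hs ht hx₀ (hlt x₀ hx₀ hx₀F) hmx₀ hy hmy
  simp only [sub_apply, smul_apply, smul_eq_mul, neg_apply] at hsa htb
  refine ⟨m - s • k, -m - t • k, a, b, hs, ht, fun x hx => ?_, fun x hx => ?_, ha, hb,
    ?_, ?_, ?_, ?_⟩
  · simp [hm x hx, (hkF x (hF.subset hx)).1 hx]
  · simp [hm x hx, (hkF x (hF.subset hx)).1 hx]
  · simpa using hsa
  · have := mul_pos_of_neg_of_neg hst (sub_neg.2 (hlt a ha haF))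
    simp only [sub_apply, smul_apply, smul_eq_mul, neg_apply]
    linarith
  · have := mul_pos_of_neg_of_neg hst (sub_neg.2 (hlt b hb hbF))
    simp only [sub_apply, smul_apply, smul_eq_mul]
    linarith
  · simpa using htb

namespace IsRidgePair

theorem mem_vectorSpan (h : IsRidgePair K F v f₁ f₂ a b) (hFK : F ⊆ K) (hv : v ∈ K)
    (hdim : finrank ℝ (vectorSpan ℝ K) = finrank ℝ (vectorSpan ℝ F) + 2) {u : E}
    (hu : u ∈ vectorSpan ℝ K) (h₁ : f₁ u = 0) (h₂ : f₂ u = 0) : u ∈ vectorSpan ℝ F := by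
  set W := vectorSpan ℝ K
  set k₁ := LinearMap.ker f₁.toLinearMap
  set k₂ := LinearMap.ker f₂.toLinearMap
  have ha : a - v ∈ W := vsub_mem_vectorSpan ℝ h.mem_a hv
  have hb : b - v ∈ W := vsub_mem_vectorSpan ℝ h.mem_b hv
  have hlt₁ : W ⊓ k₁ < W := lt_of_le_of_ne inf_le_left fun heq => by
    have : f₁ (b - v) = 0 := (heq.ge hb).2
    simp only [map_sub] at this
    linarith [h.map_b₁]
  have hlt₂ : W ⊓ k₁ ⊓ k₂ < W ⊓ k₁ := lt_of_le_of_ne inf_le_left fun heq => by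
    have ha₁ : a - v ∈ W ⊓ k₁ := ⟨ha, by simp [k₁, h.map_a₁]⟩
    have : f₂ (a - v) = 0 := (heq.ge ha₁).2
    simp only [map_sub] at this
    linarith [h.map_a₂]
  have hle : vectorSpan ℝ F ≤ W ⊓ k₁ ⊓ k₂ := fun u hu =>
    ⟨⟨vectorSpan_mono ℝ hFK hu, map_eq_zero_of_mem_vectorSpan h.const₁ hu⟩,
      map_eq_zero_of_mem_vectorSpan h.const₂ hu⟩
  have hrank₁ := Submodule.finrank_lt_finrank_of_lt hlt₁
  have hrank₂ := Submodule.finrank_lt_finrank_of_lt hlt₂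
  rw [Submodule.eq_of_le_of_finrank_le hle (by omega)]
  exact ⟨⟨hu, h₁⟩, h₂⟩

theorem isMaxOn (h : IsRidgePair K F v f₁ f₂ a b) (hFK : F ⊆ K) (hv : v ∈ K)
    (hdim : finrank ℝ (vectorSpan ℝ K) = finrank ℝ (vectorSpan ℝ F) + 2)
    (hj : ∀ x ∈ F, j x = j v) (hja : j a ≤ j v) (hjb : j b ≤ j v) : IsMaxOn j K v := by
  intro x hx
  have ha₂ := sub_neg.2 h.map_a₂
  have hb₁ := sub_neg.2 h.map_b₁
  set s := (f₂ x - f₂ v) / (f₂ a - f₂ v) with hs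
  set t := (f₁ x - f₁ v) / (f₁ b - f₁ v) with ht
  have hs0 : 0 ≤ s := div_nonneg_of_nonpos (sub_nonpos.2 (isMaxOn_iff.1 h.isMaxOn₂ x hx)) ha₂.le
  have ht0 : 0 ≤ t := div_nonneg_of_nonpos (sub_nonpos.2 (isMaxOn_iff.1 h.isMaxOn₁ x hx)) hb₁.le
  have hu : x - v - s • (a - v) - t • (b - v) ∈ vectorSpan ℝ F := by
    refine h.mem_vectorSpan hFK hv hdim (Submodule.sub_mem _ (Submodule.sub_mem _ ?_
      (Submodule.smul_mem _ _ ?_)) (Submodule.smul_mem _ _ ?_)) ?_ ?_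
    · exact vsub_mem_vectorSpan ℝ hx hv
    · exact vsub_mem_vectorSpan ℝ h.mem_a hv
    · exact vsub_mem_vectorSpan ℝ h.mem_b hv
    · simp [h.map_a₁, ht, div_mul_cancel₀ _ hb₁.ne]
    · simp [h.map_b₂, hs, div_mul_cancel₀ _ ha₂.ne]
  have hju := map_eq_zero_of_mem_vectorSpan hj hu
  simp only [map_sub, map_smul, smul_eq_mul] at hju
  have := mul_nonneg hs0 (sub_nonneg.2 hja)
  have := mul_nonneg ht0 (sub_nonneg.2 hjb)
  simp only [Set.mem_ofPred_eq]
  linarith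

theorem isCoveringFace (h : IsRidgePair K F v f₁ f₂ a b) (hFK : F ⊆ K) (hv : v ∈ F)
    (hdim : finrank ℝ (vectorSpan ℝ K) = finrank ℝ (vectorSpan ℝ F) + 2) :
    IsCoveringFace K F {x ∈ K | f₁ x = f₁ v} := by
  have hsub : F ⊆ {x ∈ K | f₁ x = f₁ v} := fun x hx => ⟨hFK hx, h.const₁ x hx⟩
  have hlt₁ := finrank_vectorSpan_lt hsub h.const₂ (hsub hv) ⟨h.mem_a, h.map_a₁⟩ h.map_a₂.ne
  have hlt₂ := finrank_vectorSpan_lt (Set.sep_subset K fun x => f₁ x = f₁ v) (fun x hx => hx.2)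
    (hFK hv) h.mem_b h.map_b₁.ne
  exact ⟨isExposed_of_isMaxOn h.isMaxOn₁, hsub, by omega⟩

theorem eq_of_mem (h : IsRidgePair K F v f₁ f₂ a b) (hFK : F ⊆ K) (hv : v ∈ F)
    (hdim : finrank ℝ (vectorSpan ℝ K) = finrank ℝ (vectorSpan ℝ F) + 2)
    (hH : IsCoveringFace K F H) (haH : a ∈ H) : H = {x ∈ K | f₁ x = f₁ v} := by
  have hH₁ := h.isCoveringFace hFK hv hdim
  set H₁ := {x ∈ K | f₁ x = f₁ v}
  have hne : (H ∩ H₁).Nonempty := ⟨v, hH.subset hv, hH₁.subset hv⟩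
  have hlt := finrank_vectorSpan_lt (Set.subset_inter hH.subset hH₁.subset) h.const₂
    ⟨hH.subset hv, hH₁.subset hv⟩ ⟨haH, h.mem_a, h.map_a₁⟩ h.map_a₂.ne
  have hexposed := hH.isExposed.inter hH₁.isExposed
  calc H = H ∩ H₁ := (eq_of_subset_of_finrank_le hexposed hne Set.inter_subset_left
        hH.isExposed.subset (by rw [hH.finrank_eq]; omega)).symm
    _ = H₁ := eq_of_subset_of_finrank_le hexposed hne Set.inter_subset_right
        hH₁.isExposed.subset (by rw [hH₁.finrank_eq]; omega)

theorem map_eq_of_map_lt (h : IsRidgePair K F v f₁ f₂ a b) (hFK : F ⊆ K) (hv : v ∈ F)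
    (hdim : finrank ℝ (vectorSpan ℝ K) = finrank ℝ (vectorSpan ℝ F) + 2)
    (hj : ∀ x ∈ F, j x = j v) (hja : j a < j v) (hjb : j b ≤ j v) {x : E} (hx : x ∈ K)
    (hjx : j x = j v) : f₂ x = f₂ v := by
  have ha₂ := sub_neg.2 h.map_a₂
  set c := (j a - j v) / (f₂ a - f₂ v)
  have hc0 : 0 < c := div_pos_of_neg_of_neg (sub_neg.2 hja) ha₂
  have hca : c * (f₂ a - f₂ v) = j a - j v := div_mul_cancel₀ _ ha₂.ne
  have hmax : IsMaxOn (j - c • f₂) K v := by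
    refine h.isMaxOn hFK (hFK hv) hdim (fun x hx => by simp [hj x hx, h.const₂ x hx]) ?_ ?_
    · simp only [sub_apply, smul_apply, smul_eq_mul]
      linarith
    · simpa [h.map_b₂] using hjb
  have hle : j x - c * f₂ x ≤ j v - c * f₂ v := isMaxOn_iff.1 hmax x hx
  exact (isMaxOn_iff.1 h.isMaxOn₂ x hx).antisymm (le_of_mul_le_mul_left (by linarith) hc0)

theorem mem_or_mem (h : IsRidgePair K F v f₁ f₂ a b) (hFK : F ⊆ K) (hv : v ∈ F)
    (hdim : finrank ℝ (vectorSpan ℝ K) = finrank ℝ (vectorSpan ℝ F) + 2)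
    (hH : IsCoveringFace K F H) : a ∈ H ∨ b ∈ H := by
  obtain ⟨j, hj, hjH⟩ := exists_isMaxOn_of_isExposed hH.isExposed (hH.subset hv)
  by_contra! hab
  have hconst : ∀ x ∈ F, j x = j v := fun x hx => (hjH x (hFK hx)).1 (hH.subset hx)
  have hlt : ∀ x ∈ K, x ∉ H → j x < j v := fun x hx hxH =>
    (isMaxOn_iff.1 hj x hx).lt_of_ne fun h => hxH ((hjH x hx).2 h)
  have hja := hlt a h.mem_a hab.1
  have hjb := hlt b h.mem_b hab.2
  have hHK := hH.isExposed.subset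
  have hle : vectorSpan ℝ H ≤ vectorSpan ℝ F := fun u hu =>
    h.mem_vectorSpan hFK (hFK hv) hdim (vectorSpan_mono ℝ hHK hu)
      (map_eq_zero_of_mem_vectorSpan (fun x hx => h.symm.map_eq_of_map_lt hFK hv hdim hconst hjb
        hja.le (hHK hx) ((hjH x (hHK hx)).1 hx)) hu)
      (map_eq_zero_of_mem_vectorSpan (fun x hx => h.map_eq_of_map_lt hFK hv hdim hconst hja
        hjb.le (hHK hx) ((hjH x (hHK hx)).1 hx)) hu)
  have := Submodule.finrank_mono hle
  rw [hH.finrank_eq] at this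
  omega

end IsRidgePair

theorem exists_two_isCoveringFace (hK : IsPolytope K) (hF : IsExposed ℝ K F) (hne : F.Nonempty)
    (hdim : finrank ℝ (vectorSpan ℝ K) = finrank ℝ (vectorSpan ℝ F) + 2) :
    ∃ H₁ H₂, H₁ ≠ H₂ ∧ ∀ H, IsCoveringFace K F H ↔ H = H₁ ∨ H = H₂ := by
  obtain ⟨v, hv⟩ := hne
  have hFK := hF.subset
  obtain ⟨f₁, f₂, a, b, h⟩ := exists_isRidgePair hK hF hv hdim
  refine ⟨{x ∈ K | f₁ x = f₁ v}, {x ∈ K | f₂ x = f₂ v}, fun heq => ?_, fun H => ⟨fun hH => ?_, ?_⟩⟩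
  · exact h.map_a₂.ne (heq.le ⟨h.mem_a, h.map_a₁⟩).2
  · exact (h.mem_or_mem hFK hv hdim hH).imp (h.eq_of_mem hFK hv hdim hH)
      (h.symm.eq_of_mem hFK hv hdim hH)
  · rintro (rfl | rfl)
    exacts [h.isCoveringFace hFK hv hdim, h.symm.isCoveringFace hFK hv hdim]

theorem exists_isCoveringFace_lt (hK : IsPolytope K) (hF : IsExposed ℝ K F) (hv : v ∈ F)
    (hdim : finrank ℝ (vectorSpan ℝ K) = finrank ℝ (vectorSpan ℝ F) + 2)
    (hj : ∀ x ∈ F, j x = j v) (hmax : ¬IsMaxOn j K v) :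
    ∃ H, IsCoveringFace K F H ∧ ∃ x ∈ H, j v < j x := by
  have hFK := hF.subset
  obtain ⟨f₁, f₂, a, b, h⟩ := exists_isRidgePair hK hF hv hdim
  by_contra! hle
  exact hmax (h.isMaxOn hFK (hFK hv) hdim hj
    (hle _ (h.isCoveringFace hFK hv hdim) a ⟨h.mem_a, h.map_a₁⟩)
    (hle _ (h.symm.isCoveringFace hFK hv hdim) b ⟨h.mem_b, h.map_b₂⟩))

end Ridges

section Codimension

variable {E : Type*} [NormedAddCommGroup E] [NormedSpace ℝ E] [FiniteDimensional ℝ E] {F K : Set E}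
  {j m : StrongDual ℝ E} {v y : E}

theorem exists_map_sub_eq_mul (hFK : F ⊆ K) (hv : v ∈ K)
    (hdim : finrank ℝ (vectorSpan ℝ K) = finrank ℝ (vectorSpan ℝ F) + 1)
    (hm : ∀ x ∈ F, m x = m v) (hj : ∀ x ∈ F, j x = j v) (hy : y ∈ K) (hmy : m y ≠ m v) :
    ∃ s : ℝ, ∀ x ∈ K, j x - j v = s * (m x - m v) := by
  have hmy' := sub_ne_zero.2 hmy
  have hyv : y - v ∈ vectorSpan ℝ K := vsub_mem_vectorSpan ℝ hy hv
  have hlt : vectorSpan ℝ K ⊓ LinearMap.ker m.toLinearMap < vectorSpan ℝ K :=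
    lt_of_le_of_ne inf_le_left fun heq => hmy' <| by simpa using (heq.ge hyv).2
  have hle : vectorSpan ℝ F ≤ vectorSpan ℝ K ⊓ LinearMap.ker m.toLinearMap := fun u hu =>
    ⟨vectorSpan_mono ℝ hFK hu, map_eq_zero_of_mem_vectorSpan hm hu⟩
  have hrank := Submodule.finrank_lt_finrank_of_lt hlt
  have heq := Submodule.eq_of_le_of_finrank_le hle (by omega)
  refine ⟨(j y - j v) / (m y - m v), fun x hx => ?_⟩
  set c := (m x - m v) / (m y - m v) with hc
  have hu : x - v - c • (y - v) ∈ vectorSpan ℝ F := by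
    rw [heq]
    exact ⟨Submodule.sub_mem _ (vsub_mem_vectorSpan ℝ hx hv) (Submodule.smul_mem _ _ hyv),
      by simp [hc, div_mul_cancel₀ _ hmy']⟩
  have hju := map_eq_zero_of_mem_vectorSpan hj hu
  simp only [map_sub, map_smul, smul_eq_mul] at hju
  rw [sub_eq_zero.1 hju, hc]
  field_simp

theorem map_lt_of_notMem {w x : E} (hF : IsExposed ℝ K F) (hv : v ∈ F)
    (hdim : finrank ℝ (vectorSpan ℝ K) = finrank ℝ (vectorSpan ℝ F) + 1)
    (hj : ∀ x ∈ F, j x = j v) (hw : w ∈ K) (hjw : j v < j w) (hx : x ∈ K) (hxF : x ∉ F) :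
    j v < j x := by
  have hFK := hF.subset
  obtain ⟨k, hk, hkF⟩ := exists_isMaxOn_of_isExposed hF hv
  have hlt : ∀ y ∈ K, y ∉ F → k y < k v := fun y hy hyF =>
    (isMaxOn_iff.1 hk y hy).lt_of_ne fun h => hyF ((hkF y hy).2 h)
  have hkw := hlt w hw fun h => hjw.ne (hj w h).symm
  obtain ⟨c, hc⟩ := exists_map_sub_eq_mul hFK (hFK hv) hdim
    (fun y hy => (hkF y (hFK hy)).1 hy) hj hw hkw.ne
  have hc0 : c < 0 := by nlinarith [hc w hw]
  have hpos := mul_pos_of_neg_of_neg hc0 (sub_neg.2 (hlt x hx hxF))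
  rwa [← hc x hx, sub_pos] at hpos

end Codimension

section Segments

variable {E : Type*} [NormedAddCommGroup E] [NormedSpace ℝ E] {A : Set E}

theorem isExposed_singleton_of_injOn {m : StrongDual ℝ E} {b : E} (hm : Set.InjOn m A) (hb : b ∈ A)
    (hmax : IsMaxOn m A b) : IsExposed ℝ A {b} := by
  have h : {x ∈ A | m x = m b} = {b} :=
    Set.eq_singleton_iff_unique_mem.2 ⟨⟨hb, rfl⟩, fun x hx => hm hx.1 hb hx.2⟩
  exact h ▸ isExposed_of_isMaxOn hmax

variable [FiniteDimensional ℝ E]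

theorem exists_map_sub_eq_mul_of_finrank_eq_one {m : StrongDual ℝ E} {v y : E}
    (hA : finrank ℝ (vectorSpan ℝ A) = 1) (hv : v ∈ A) (hy : y ∈ A) (hmy : m y ≠ m v)
    (j : StrongDual ℝ E) : ∃ s : ℝ, ∀ x ∈ A, j x - j v = s * (m x - m v) :=
  exists_map_sub_eq_mul (Set.singleton_subset_iff.2 hv) hv (by simp [hA]) (by simp) (by simp) hy hmy

theorem exists_injOn_of_finrank_eq_one (hA : finrank ℝ (vectorSpan ℝ A) = 1) :
    ∃ m : StrongDual ℝ E, Set.InjOn m A := by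
  obtain ⟨p, hp, q, hq, hpq⟩ := finrank_vectorSpan_pos_iff.1 (hA ▸ one_pos)
  obtain ⟨m, hm⟩ := SeparatingDual.exists_separating_of_ne (R := ℝ) hpq
  refine ⟨m, fun x hx y hy hxy => ?_⟩
  by_contra hne
  obtain ⟨j, hj⟩ := SeparatingDual.exists_separating_of_ne (R := ℝ) hne
  obtain ⟨z, hz, hzy⟩ : ∃ z ∈ A, m z ≠ m y := by
    by_contra! h
    exact hm ((h p hp).trans (h q hq).symm)
  obtain ⟨s, hs⟩ := exists_map_sub_eq_mul_of_finrank_eq_one hA hy hz hzy j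
  exact hj (sub_eq_zero.1 (by rw [hs x hx, hxy, sub_self, mul_zero]))

theorem exists_two_isExposed_singleton (hcompact : IsCompact A)
    (hA : finrank ℝ (vectorSpan ℝ A) = 1) :
    ∃ a b, a ≠ b ∧ ∀ x, IsExposed ℝ A {x} ↔ x = a ∨ x = b := by
  obtain ⟨m, hm⟩ := exists_injOn_of_finrank_eq_one hA
  have hnontrivial := finrank_vectorSpan_pos_iff.1 (hA ▸ one_pos)
  obtain ⟨a, ha, hamin⟩ := hcompact.exists_isMinOn hnontrivial.nonempty m.continuous.continuousOn
  obtain ⟨b, hb, hbmax⟩ := hcompact.exists_isMaxOn hnontrivial.nonempty m.continuous.continuousOn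
  have hmin := isMinOn_iff.1 hamin
  have hmax := isMaxOn_iff.1 hbmax
  refine ⟨a, b, fun hab => ?_, fun x => ⟨fun hx => ?_, ?_⟩⟩
  · obtain ⟨p, hp, q, hq, hpq⟩ := hnontrivial
    subst hab
    exact hpq (hm hp hq (((hmax p hp).antisymm (hmin p hp)).trans
      ((hmax q hq).antisymm (hmin q hq)).symm))
  · have hxA : x ∈ A := hx.subset rfl
    obtain ⟨f, hf, hfx⟩ := exists_isMaxOn_of_isExposed hx (Set.mem_singleton x)
    by_contra! hne
    have hax : m a < m x := (hmin x hxA).lt_of_ne fun h => hne.1 (hm ha hxA h).symm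
    have hxb : m x < m b := (hmax x hxA).lt_of_ne fun h => hne.2 (hm hxA hb h)
    have hfa : f a < f x := (isMaxOn_iff.1 hf a ha).lt_of_ne fun h => hne.1 ((hfx a ha).2 h).symm
    have hfb : f b < f x := (isMaxOn_iff.1 hf b hb).lt_of_ne fun h => hne.2 ((hfx b hb).2 h).symm
    obtain ⟨s, hs⟩ := exists_map_sub_eq_mul_of_finrank_eq_one hA hxA ha hax.ne f
    nlinarith [hs a ha, hs b hb]
  · rintro (rfl | rfl)
    · exact isExposed_singleton_of_injOn (m := -m)
        (fun p hp q hq h => hm hp hq (neg_injective h)) ha hamin.neg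
    · exact isExposed_singleton_of_injOn hm hb hbmax

end Segments

theorem exists_two_subtype {α : Type*} {p q : α → Prop}
    (h : ∃ a b, a ≠ b ∧ ∀ x, p x ∧ q x ↔ x = a ∨ x = b) :
    ∃ a b : {x // p x}, a ≠ b ∧ ∀ x : {x // p x}, q x ↔ x = a ∨ x = b := by
  obtain ⟨a, b, hab, h⟩ := h
  refine ⟨⟨a, ((h a).2 (.inl rfl)).1⟩, ⟨b, ((h b).2 (.inr rfl)).1⟩,
    fun h => hab (congrArg Subtype.val h), fun x => ?_⟩
  rw [Subtype.ext_iff, Subtype.ext_iff, ← h]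
  exact ⟨fun hx => ⟨x.2, hx⟩, And.right⟩

namespace ConvexPolyhedron

variable {P : ConvexPolyhedron}

theorem isPolytope (P : ConvexPolyhedron) : IsPolytope P.carrier :=
  P.exists_hull

theorem isFace_carrier (P : ConvexPolyhedron) : P.IsFace 3 P.carrier := by
  refine ⟨P.nonempty_interior.mono interior_subset, .refl _, ?_⟩
  have h := P.nonempty_interior
  rw [← P.isPolytope.convex.convexHull_eq, interior_convexHull_nonempty_iff_affineSpan_eq_top] at h
  rw [← direction_affineSpan, h, AffineSubspace.direction_top, finrank_top,
    finrank_euclideanSpace_fin]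

theorem finite_setOf_isFace (P : ConvexPolyhedron) (k : ℕ) : {F | P.IsFace k F}.Finite :=
  P.isPolytope.finite_setOf_isExposed.subset fun _ hF => hF.2.1

instance : Finite P.Vertex := (P.finite_setOf_isFace 0).to_subtype

instance : Finite P.Edge := (P.finite_setOf_isFace 1).to_subtype

noncomputable instance : Fintype P.Vertex := Fintype.ofFinite _

noncomputable instance : Fintype P.Edge := Fintype.ofFinite _

namespace IsFace

variable {k l : ℕ} {F G H : Set Space3}

theorem isPolytope (hF : P.IsFace k F) : IsPolytope F :=
  P.isPolytope.of_isExposed hF.2.1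

theorem isCoveringFace_iff (hF : P.IsFace k F) (hG : P.IsFace l G) :
    IsCoveringFace G F H ↔ P.IsFace (k + 1) H ∧ F ⊆ H ∧ H ⊆ G := by
  refine ⟨fun h => ⟨⟨hF.1.mono h.subset, P.isPolytope.isExposed_trans hG.2.1 h.isExposed, ?_⟩,
    h.subset, h.isExposed.subset⟩, fun ⟨hH, hFH, hHG⟩ => ⟨hH.2.1.mono hG.2.1.subset hHG, hFH, ?_⟩⟩
  · rw [h.finrank_eq, hF.2.2]
  · rw [hH.2.2, hF.2.2]

theorem exists_two_between (hF : P.IsFace k F) (hG : P.IsFace (k + 2) G) (hFG : F ⊆ G) :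
    ∃ H₁ H₂, H₁ ≠ H₂ ∧ ∀ H, P.IsFace (k + 1) H ∧ F ⊆ H ∧ H ⊆ G ↔ H = H₁ ∨ H = H₂ := by
  simp only [← hF.isCoveringFace_iff hG]
  exact exists_two_isCoveringFace hG.isPolytope (hF.2.1.mono hG.2.1.subset hFG) hF.1
    (by rw [hF.2.2, hG.2.2])

theorem eq_of_subset (hF : P.IsFace k F) (hG : P.IsFace k G) (hFG : F ⊆ G) : F = G :=
  eq_of_subset_of_finrank_le hF.2.1 hF.1 hFG hG.2.1.subset (by rw [hF.2.2, hG.2.2])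

theorem finrank_inter_lt (hF : P.IsFace k F) (hG : P.IsFace k G) (hne : F ≠ G)
    (h : (F ∩ G).Nonempty) : finrank ℝ (vectorSpan ℝ (F ∩ G)) < k := by
  by_contra! hk
  have hFG := eq_of_subset_of_finrank_le (hF.2.1.inter hG.2.1) h Set.inter_subset_left hF.2.1.subset
    (hF.2.2.trans_le hk)
  exact hne (hF.eq_of_subset hG (Set.inter_eq_left.1 hFG))

end IsFace

/-- The point of a vertex, which is encoded as a singleton. -/
noncomputable def Vertex.pt (v : P.Vertex) : Space3 := v.2.1.some

namespace Vertex

theorem eq_singleton (v : P.Vertex) : v.1 = {v.pt} := by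
  have h : v.1.Subsingleton := by
    rw [← vectorSpan_eq_bot_iff_subsingleton ℝ, ← Submodule.finrank_eq_zero, v.2.2.2]
  exact h.eq_singleton_of_mem v.2.1.some_mem

theorem subset_iff (v : P.Vertex) {A : Set Space3} : v.1 ⊆ A ↔ v.pt ∈ A := by
  rw [v.eq_singleton, Set.singleton_subset_iff]

theorem pt_injective : Function.Injective (pt : P.Vertex → Space3) := fun v w h =>
  Subtype.ext (by rw [v.eq_singleton, w.eq_singleton, h])

theorem isExposed (v : P.Vertex) : IsExposed ℝ P.carrier {v.pt} :=
  v.eq_singleton ▸ v.2.2.1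

end Vertex

theorem isFace_zero_singleton_iff {x : Space3} : P.IsFace 0 {x} ↔ IsExposed ℝ P.carrier {x} := by
  simp [IsFace]

theorem Edge.exists_vertices (e : P.Edge) :
    ∃ v w : P.Vertex, v ≠ w ∧ ∀ u : P.Vertex, u.1 ⊆ e.1 ↔ u = v ∨ u = w := by
  obtain ⟨a, b, hab, h⟩ := exists_two_isExposed_singleton e.2.isPolytope.isCompact e.2.2.2
  refine exists_two_subtype (p := P.IsFace 0) (q := (· ⊆ e.1))
    ⟨{a}, {b}, Set.singleton_injective.ne hab, fun F => ⟨fun hF => ?_, ?_⟩⟩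
  · obtain ⟨x, rfl⟩ : ∃ x, F = {x} := ⟨_, Vertex.eq_singleton ⟨F, hF.1⟩⟩
    simpa using (h x).1 (hF.1.2.1.mono e.2.2.1.subset hF.2)
  · have hface : ∀ x, IsExposed ℝ e.1 {x} → P.IsFace 0 {x} ∧ {x} ⊆ e.1 := fun x hx =>
      ⟨isFace_zero_singleton_iff.2 (P.isPolytope.isExposed_trans e.2.2.1 hx), hx.subset⟩
    rintro (rfl | rfl)
    exacts [hface _ ((h _).2 (.inl rfl)), hface _ ((h _).2 (.inr rfl))]

theorem Edge.exists_facets (e : P.Edge) :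
    ∃ F G : P.Facet, F ≠ G ∧ ∀ H : P.Facet, e.1 ⊆ H.1 ↔ H = F ∨ H = G := by
  obtain ⟨F, G, hFG, h⟩ := e.2.exists_two_between P.isFace_carrier e.2.2.1.subset
  refine exists_two_subtype ⟨F, G, hFG, fun H => ?_⟩
  rw [← h]
  exact and_congr_right fun hH => (and_iff_left hH.2.1.subset).symm

theorem exists_edges_at {v : P.Vertex} {F : P.Facet} (h : v.1 ⊆ F.1) :
    ∃ d e : P.Edge, d ≠ e ∧ ∀ z : P.Edge, v.1 ⊆ z.1 ∧ z.1 ⊆ F.1 ↔ z = d ∨ z = e :=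
  exists_two_subtype (v.2.exists_two_between F.2 h)

theorem exists_edge_eq_inter {F G : P.Facet} (hFG : F ≠ G) {v w : P.Vertex} (hvw : v ≠ w)
    (hv : v.1 ⊆ F.1 ∩ G.1) (hw : w.1 ⊆ F.1 ∩ G.1) : ∃ e : P.Edge, e.1 = F.1 ∩ G.1 := by
  have hne : (F.1 ∩ G.1).Nonempty := v.2.1.mono hv
  have hlt := F.2.finrank_inter_lt G.2 (Subtype.coe_injective.ne hFG) hne
  have hpos : 0 < finrank ℝ (vectorSpan ℝ (F.1 ∩ G.1)) := finrank_vectorSpan_pos_iff.2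
    ⟨v.pt, v.subset_iff.1 hv, w.pt, w.subset_iff.1 hw, Vertex.pt_injective.ne hvw⟩
  exact ⟨⟨_, hne, F.2.2.1.inter G.2.2.1, by omega⟩, rfl⟩

namespace Edge

theorem eq_of_mem {d e : P.Edge} {x y : Space3} (hxy : x ≠ y) (hxd : x ∈ d.1) (hyd : y ∈ d.1)
    (hxe : x ∈ e.1) (hye : y ∈ e.1) : d = e := by
  by_contra hde
  have hlt := d.2.finrank_inter_lt e.2 (Subtype.coe_injective.ne hde) ⟨x, hxd, hxe⟩
  have hpos : 0 < finrank ℝ (vectorSpan ℝ (d.1 ∩ e.1)) :=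
    finrank_vectorSpan_pos_iff.2 ⟨x, ⟨hxd, hxe⟩, y, ⟨hyd, hye⟩, hxy⟩
  omega

theorem ext_vertices {d e : P.Edge} (h : ∀ v : P.Vertex, v.1 ⊆ d.1 ↔ v.1 ⊆ e.1) : d = e := by
  obtain ⟨v, w, hvw, hd⟩ := d.exists_vertices
  have hv := (hd v).2 (.inl rfl)
  have hw := (hd w).2 (.inr rfl)
  exact eq_of_mem (Vertex.pt_injective.ne hvw) (v.subset_iff.1 hv) (w.subset_iff.1 hw)
    (v.subset_iff.1 ((h v).1 hv)) (w.subset_iff.1 ((h w).1 hw))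

theorem nontrivial (e : P.Edge) : e.1.Nontrivial :=
  finrank_vectorSpan_pos_iff.1 (one_pos.trans_eq e.2.2.2.symm)

end Edge

section Sweep

variable {v : P.Vertex} {e : P.Edge} {η p : StrongDual ℝ Space3} {s : ℝ}

theorem Edge.exists_slope (hp : ∀ x ∈ P.carrier, x ≠ v.pt → p x < p v.pt) (hv : v.1 ⊆ e.1)
    (η : StrongDual ℝ Space3) : ∃ s : ℝ, ∀ x ∈ e.1, η x - η v.pt = s * (p v.pt - p x) := by
  obtain ⟨y, hy, hyv⟩ := e.nontrivial.exists_ne v.pt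
  obtain ⟨s, hs⟩ := exists_map_sub_eq_mul_of_finrank_eq_one e.2.2.2 (v.subset_iff.1 hv) hy
    (hp y (e.2.2.1.subset hy) hyv).ne η
  exact ⟨-s, fun x hx => by rw [hs x hx]; ring⟩

theorem exists_facet_slope_le (hv : v.1 ⊆ e.1)
    (hs : ∀ x ∈ e.1, η x - η v.pt = s * (p v.pt - p x)) {z : Space3} (hz : z ∈ P.carrier)
    (hzs : s * (p v.pt - p z) < η z - η v.pt) :
    ∃ F : P.Facet, e.1 ⊆ F.1 ∧ (∀ x ∈ F.1, s * (p v.pt - p x) ≤ η x - η v.pt) ∧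
      ∀ x ∈ F.1, x ∉ e.1 → s * (p v.pt - p x) < η x - η v.pt := by
  set j := η + s • p with hj
  have hje : ∀ x ∈ e.1, j x = j v.pt := fun x hx => by
    simp only [hj, add_apply, smul_apply, smul_eq_mul]
    linarith [hs x hx]
  have hjz : ¬IsMaxOn j P.carrier v.pt := fun h => by
    have hle := isMaxOn_iff.1 h z hz
    simp only [hj, add_apply, smul_apply, smul_eq_mul] at hle
    linarith
  obtain ⟨F, hF, w, hw, hjw⟩ := exists_isCoveringFace_lt P.isPolytope e.2.2.1 (v.subset_iff.1 hv)
    (by rw [P.isFace_carrier.2.2, e.2.2.2]) hje hjz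
  obtain ⟨hFace, heF, -⟩ := (e.2.isCoveringFace_iff P.isFace_carrier).1 hF
  have hoff : ∀ x ∈ F, x ∉ e.1 → s * (p v.pt - p x) < η x - η v.pt := fun x hx hxe => by
    have hjx := map_lt_of_notMem (e.2.2.1.mono hFace.2.1.subset heF) (v.subset_iff.1 hv)
      hF.finrank_eq hje hw hjw hx hxe
    simp only [hj, add_apply, smul_apply, smul_eq_mul] at hjx
    linarith
  refine ⟨⟨F, hFace⟩, heF, fun x hx => ?_, hoff⟩
  by_cases hxe : x ∈ e.1
  exacts [(hs x hxe).ge, (hoff x hx hxe).le]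

theorem exists_adjacent_edge_lt_slope (hp : ∀ x ∈ P.carrier, x ≠ v.pt → p x < p v.pt)
    (hv : v.1 ⊆ e.1) (hs : ∀ x ∈ e.1, η x - η v.pt = s * (p v.pt - p x)) (hs0 : 0 < s)
    {z : Space3} (hz : z ∈ P.carrier) (hzs : s * (p v.pt - p z) < η z - η v.pt) :
    ∃ F : P.Facet, (∀ x ∈ F.1, x ≠ v.pt → η v.pt < η x) ∧ e.1 ⊆ F.1 ∧
      ∃ d : P.Edge, v.1 ⊆ d.1 ∧ d.1 ⊆ F.1 ∧
        ∀ x ∈ d.1, x ≠ v.pt → s * (p v.pt - p x) < η x - η v.pt := by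
  obtain ⟨F, heF, hle, hlt⟩ := exists_facet_slope_le hv hs hz hzs
  obtain ⟨d, hde, hvd, hdF⟩ : ∃ d : P.Edge, d ≠ e ∧ v.1 ⊆ d.1 ∧ d.1 ⊆ F.1 := by
    obtain ⟨d, d', hdd', hd⟩ := exists_edges_at (hv.trans heF)
    by_cases hde : d = e
    · exact ⟨d', fun h => hdd' (hde.trans h.symm), (hd d').2 (.inr rfl)⟩
    · exact ⟨d, hde, (hd d).2 (.inl rfl)⟩
  refine ⟨F, fun x hx hxv => ?_, heF, d, hvd, hdF, fun x hx hxv => hlt x (hdF hx) fun hxe => ?_⟩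
  · have := mul_pos hs0 (sub_pos.2 (hp x (F.2.2.1.subset hx) hxv))
    linarith [hle x hx]
  · exact hde (Edge.eq_of_mem hxv hx (v.subset_iff.1 hvd) hxe (v.subset_iff.1 hv))

/-- Adding to `p` a large multiple of a functional exposing `e` keeps the slope along `e` and lowers
the slope of every other direction. -/
theorem exists_steepest (hv : v.1 ⊆ e.1) (hη : ∃ x ∈ e.1, η v.pt < η x) :
    ∃ p : StrongDual ℝ Space3, (∀ x ∈ P.carrier, x ≠ v.pt → p x < p v.pt) ∧
      ∃ s : ℝ, (∀ x ∈ e.1, η x - η v.pt = s * (p v.pt - p x)) ∧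
        ∀ x ∈ P.carrier, x ∉ e.1 → η x - η v.pt < s * (p v.pt - p x) := by
  obtain ⟨p₀, hmax, hp₀⟩ := exists_isMaxOn_of_isExposed v.isExposed (Set.mem_singleton v.pt)
  have hlt : ∀ x ∈ P.carrier, x ≠ v.pt → p₀ x < p₀ v.pt := fun x hx hxv =>
    (isMaxOn_iff.1 hmax x hx).lt_of_ne fun h => hxv ((hp₀ x hx).2 h)
  obtain ⟨s, hs⟩ := Edge.exists_slope hlt hv η
  obtain ⟨y, hy, hηy⟩ := hη
  have hs0 : 0 < s := by
    have := hlt y (e.2.2.1.subset hy) fun h => by simp [h] at hηy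
    nlinarith [hs y hy]
  obtain ⟨q, hq, hqe⟩ := exists_isMaxOn_of_isExposed e.2.2.1 (v.subset_iff.1 hv)
  have hconst : ∀ x ∈ P.carrier, q x = q v.pt → (η + s • p₀) x ≤ (η + s • p₀) v.pt := by
    intro x hx h
    have := hs x ((hqe x hx).2 h)
    simp only [add_apply, smul_apply, smul_eq_mul]
    linarith
  obtain ⟨N, hN0, hN, hNe⟩ := P.isPolytope.exists_isMaxOn_add_smul hq hconst
  refine ⟨p₀ + (N / s) • q, fun x hx hxv => ?_, s, fun x hx => ?_, fun x hx hxe => ?_⟩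
  · have hqx := mul_le_mul_of_nonneg_left (isMaxOn_iff.1 hq x hx) (div_nonneg hN0 hs0.le)
    exact add_lt_add_of_lt_of_le (hlt x hx hxv) hqx
  · simp [(hqe x (e.2.2.1.subset hx)).1 hx, hs x hx]
  · have := (isMaxOn_iff.1 hN x hx).lt_of_ne fun h => hxe ((hqe x hx).2 ((hNe x hx).1 h).2)
    simp only [add_apply, smul_apply, smul_eq_mul] at this ⊢
    field_simp
    linarith

/-- The ascending part of the vertex figure is connected: an ascending edge of maximal slope among
those with `g d ≠ g e` would share a facet with a steeper one. -/
theorem eq_of_ascending {α : Type*} {g : P.Edge → α} {d : P.Edge}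
    (hg : ∀ F : P.Facet, (∀ x ∈ F.1, x ≠ v.pt → η v.pt < η x) → ∀ d e : P.Edge,
      v.1 ⊆ d.1 → d.1 ⊆ F.1 → v.1 ⊆ e.1 → e.1 ⊆ F.1 → g d = g e)
    (hvd : v.1 ⊆ d.1) (hd : ∃ x ∈ d.1, η v.pt < η x)
    (hve : v.1 ⊆ e.1) (he : ∃ x ∈ e.1, η v.pt < η x) : g d = g e := by
  obtain ⟨p, hp, s, hse, hlt⟩ := exists_steepest hve he
  choose! slope hslope using fun (d : P.Edge) (hd : v.1 ⊆ d.1) => Edge.exists_slope hp hd η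
  by_contra hne
  obtain ⟨d, ⟨hvd, ⟨x, hx, hηx⟩, hdne⟩, hmax⟩ := Set.exists_max_image
    {d : P.Edge | v.1 ⊆ d.1 ∧ (∃ x ∈ d.1, η v.pt < η x) ∧ g d ≠ g e} slope (Set.toFinite _)
    ⟨d, hvd, hd, hne⟩
  have hpos : ∀ y ∈ P.carrier, η v.pt < η y → 0 < p v.pt - p y := fun y hy hηy =>
    sub_pos.2 (hp y hy fun h => by simp [h] at hηy)
  have hslope0 : 0 < slope d := by
    nlinarith [hslope d hvd x hx, hpos x (d.2.2.1.subset hx) hηx]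
  have hslope_lt : slope d < s := by
    obtain ⟨y, hy, hyv⟩ := d.nontrivial.exists_ne v.pt
    have hye : y ∉ e.1 := fun hye =>
      hdne (congrArg g (Edge.eq_of_mem hyv hy (v.subset_iff.1 hvd) hye (v.subset_iff.1 hve)))
    have hyP := d.2.2.1.subset hy
    exact lt_of_mul_lt_mul_right (hslope d hvd y hy ▸ hlt y hyP hye) (sub_pos.2 (hp y hyP hyv)).le
  obtain ⟨z, hz, hηz⟩ := he
  have hzP := e.2.2.1.subset hz
  obtain ⟨F, hF, hdF, d', hvd', hd'F, hd'⟩ := exists_adjacent_edge_lt_slope hp hvd (hslope d hvd)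
    hslope0 hzP (hse z hz ▸ mul_lt_mul_of_pos_right hslope_lt (hpos z hzP hηz))
  obtain ⟨y, hy, hyv⟩ := d'.nontrivial.exists_ne v.pt
  have hle := hmax d' ⟨hvd', ⟨y, hy, hF y (hd'F hy) hyv⟩,
    hg F hF d d' hvd hdF hvd' hd'F ▸ hdne⟩
  refine hle.not_gt (lt_of_mul_lt_mul_right (hslope d' hvd' y hy ▸ hd' y hy hyv) ?_)
  exact (sub_pos.2 (hp y (d'.2.2.1.subset hy) hyv)).le

end Sweep

section Codes

open Classical in
/-- The word with entry `f v + f w` at the edge joining `v` and `w`. -/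
noncomputable def coboundary (f : P.Vertex → ZMod 2) : P.Edge → ZMod 2 := fun e =>
  ∑ v with v.1 ⊆ e.1, f v

open Classical in
/-- The words orthogonal to the boundary of every facet: the cocycles, modulo two, of the cell
structure of the boundary sphere of `P`. -/
def IsCocycle (x : P.Edge → ZMod 2) : Prop :=
  ∀ F : P.Facet, ∑ e with e.1 ⊆ F.1, x e = 0

theorem coboundary_add (f g : P.Vertex → ZMod 2) :
    coboundary (f + g) = coboundary f + coboundary g :=
  funext fun _ => Finset.sum_add_distrib

open Classical in
theorem coboundary_single (v : P.Vertex) (c : ZMod 2) (e : P.Edge) :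
    coboundary (Pi.single v c) e = if v.1 ⊆ e.1 then c else 0 := by
  simp [coboundary, Finset.sum_pi_single']

open Classical in
theorem sum_edges_at_eq_zero (v : P.Vertex) (F : P.Facet) (c : ZMod 2) :
    ∑ e : P.Edge with v.1 ⊆ e.1 ∧ e.1 ⊆ F.1, c = 0 := by
  by_cases hvF : v.1 ⊆ F.1
  · obtain ⟨d, e, hde, h⟩ := exists_edges_at hvF
    have hpair : ({z | v.1 ⊆ z.1 ∧ z.1 ⊆ F.1} : Finset P.Edge) = {d, e} := by
      ext z
      simp [h]
    rw [hpair, Finset.sum_pair hde, CharTwo.add_self_eq_zero]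
  · rw [Finset.filter_false_of_mem fun e _ he => hvF (he.1.trans he.2), Finset.sum_empty]

theorem isCocycle_coboundary (f : P.Vertex → ZMod 2) : IsCocycle (coboundary f) := by
  classical
  intro F
  calc ∑ e with e.1 ⊆ F.1, ∑ v with v.1 ⊆ e.1, f v
      = ∑ v, ∑ e : P.Edge with v.1 ⊆ e.1 ∧ e.1 ⊆ F.1, f v :=
        Finset.sum_comm' fun e v => by simp [and_comm]
    _ = 0 := Finset.sum_eq_zero fun v _ => sum_edges_at_eq_zero v F (f v)

theorem IsCocycle.add {x y : P.Edge → ZMod 2} (hx : IsCocycle x) (hy : IsCocycle y) :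
    IsCocycle (x + y) := fun F => by
  simp only [Pi.add_apply, Finset.sum_add_distrib, hx F, hy F, add_zero]

theorem exists_injective_strongDual (P : ConvexPolyhedron) :
    ∃ η : StrongDual ℝ Space3, Function.Injective fun v : P.Vertex => η v.pt := by
  obtain ⟨η, hη⟩ := Module.exists_dual_forall_apply_ne_zero (K := ℝ)
    (fun vw : {vw : P.Vertex × P.Vertex // vw.1 ≠ vw.2} => vw.1.1.pt - vw.1.2.pt)
    fun vw => sub_ne_zero.2 (Vertex.pt_injective.ne vw.2)
  refine ⟨η.toContinuousLinearMap, fun v w h => ?_⟩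
  by_contra hvw
  exact hη ⟨(v, w), hvw⟩ (by simpa [sub_eq_zero] using h)

theorem IsCocycle.eq_of_facet {x : P.Edge → ZMod 2} (hx : IsCocycle x) {v : P.Vertex} {F : P.Facet}
    (hvanish : ∀ e : P.Edge, e.1 ⊆ F.1 → ¬v.1 ⊆ e.1 → x e = 0) {d e : P.Edge} (hvd : v.1 ⊆ d.1)
    (hdF : d.1 ⊆ F.1) (hve : v.1 ⊆ e.1) (heF : e.1 ⊆ F.1) : x d = x e := by
  classical
  by_cases hde : d = e
  · rw [hde]
  obtain ⟨a, b, -, hab⟩ := exists_edges_at (hvd.trans hdF)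
  have hpair : ∀ z : P.Edge, z ≠ d ∧ z ≠ e → z.1 ⊆ F.1 → x z = 0 := fun z hz hzF => by
    refine hvanish z hzF fun hvz => ?_
    have hd := (hab d).1 ⟨hvd, hdF⟩
    have he := (hab e).1 ⟨hve, heF⟩
    have hz' := (hab z).1 ⟨hvz, hzF⟩
    grind
  have hsum := hx F
  rw [Finset.sum_filter, Finset.sum_eq_add d e hde (fun z _ hz => by
    simpa using hpair z hz) (by simp) (by simp), if_pos hdF, if_pos heF] at hsum
  exact CharTwo.add_eq_zero.1 hsum

theorem IsCocycle.exists_ascending_eq {x : P.Edge → ZMod 2} (hx : IsCocycle x) (v : P.Vertex)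
    (η : StrongDual ℝ Space3)
    (hvanish : ∀ e : P.Edge, (∀ w : P.Vertex, w.1 ⊆ e.1 → η v.pt < η w.pt) → x e = 0) :
    ∃ c, ∀ e : P.Edge, v.1 ⊆ e.1 → (∀ w : P.Vertex, w.1 ⊆ e.1 → w ≠ v → η v.pt < η w.pt) →
      x e = c := by
  have hpoint : ∀ e : P.Edge, (∀ w : P.Vertex, w.1 ⊆ e.1 → w ≠ v → η v.pt < η w.pt) →
      ∃ y ∈ e.1, η v.pt < η y := by
    intro e he
    obtain ⟨a, b, hab, h⟩ := e.exists_vertices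
    obtain ⟨w, hwe, hwv⟩ : ∃ w : P.Vertex, w.1 ⊆ e.1 ∧ w ≠ v := by
      by_cases hav : a = v
      · exact ⟨b, (h b).2 (.inr rfl), fun hbv => hab (hav.trans hbv.symm)⟩
      · exact ⟨a, (h a).2 (.inl rfl), hav⟩
    exact ⟨w.pt, w.subset_iff.1 hwe, he w hwe hwv⟩
  have hfacet : ∀ F : P.Facet, (∀ y ∈ F.1, y ≠ v.pt → η v.pt < η y) → ∀ d e : P.Edge,
      v.1 ⊆ d.1 → d.1 ⊆ F.1 → v.1 ⊆ e.1 → e.1 ⊆ F.1 → x d = x e := fun F hF d e hvd hdF hve heF =>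
    hx.eq_of_facet (fun z hzF hvz => hvanish z fun w hwz =>
      hF w.pt (w.subset_iff.1 (hwz.trans hzF)) (Vertex.pt_injective.ne fun h => hvz (h ▸ hwz)))
      hvd hdF hve heF
  by_cases h : ∃ e : P.Edge, v.1 ⊆ e.1 ∧ ∀ w : P.Vertex, w.1 ⊆ e.1 → w ≠ v → η v.pt < η w.pt
  · obtain ⟨e, hve, he⟩ := h
    exact ⟨x e, fun d hvd hd =>
      eq_of_ascending hfacet hvd (hpoint d hd) hve (hpoint e he)⟩
  · exact ⟨0, fun e hve he => absurd ⟨e, hve, he⟩ h⟩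

theorem IsCocycle.exists_add_coboundary_eq_zero {x : P.Edge → ZMod 2} (hx : IsCocycle x)
    {η : StrongDual ℝ Space3} (hη : Function.Injective fun v : P.Vertex => η v.pt)
    (s : Finset P.Vertex) (hs : ∀ v ∈ s, ∀ w : P.Vertex, η v.pt < η w.pt → w ∈ s) :
    ∃ f : P.Vertex → ZMod 2, ∀ e : P.Edge, (∀ v : P.Vertex, v.1 ⊆ e.1 → v ∈ s) →
      (x + coboundary f) e = 0 := by
  classical
  induction s using Finset.induction_on_min_value fun v : P.Vertex => η v.pt with
  | empty =>
    refine ⟨0, fun e he => ?_⟩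
    obtain ⟨v, w, -, hv⟩ := e.exists_vertices
    exact absurd (he v ((hv v).2 (.inl rfl))) (Finset.notMem_empty v)
  | insert a s _ hmin ih =>
    obtain ⟨f, hf⟩ := ih fun v hv w hvw => Finset.mem_of_mem_insert_of_ne
      (hs v (Finset.mem_insert_of_mem hv) w hvw) fun h => (hmin v hv).not_gt (h ▸ hvw)
    have habove : ∀ w : P.Vertex, η a.pt < η w.pt → w ∈ s := fun w hw =>
      Finset.mem_of_mem_insert_of_ne (hs a (Finset.mem_insert_self a s) w hw)
        fun h => hw.ne (h ▸ rfl)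
    have hcocycle := hx.add (isCocycle_coboundary f)
    obtain ⟨c, hc⟩ := hcocycle.exists_ascending_eq a η fun e he => hf e fun w hw =>
      habove w (he w hw)
    refine ⟨f + Pi.single a c, fun e he => ?_⟩
    have hmem : ∀ w : P.Vertex, w.1 ⊆ e.1 → w ≠ a → w ∈ s := fun w hw hwa =>
      Finset.mem_of_mem_insert_of_ne (he w hw) hwa
    rw [coboundary_add, ← add_assoc, Pi.add_apply, coboundary_single]
    split_ifs with hae
    · rw [hc e hae fun w hw hwa => (hmin w (hmem w hw hwa)).lt_of_ne fun h => hwa (hη h).symm,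
        CharTwo.add_self_eq_zero]
    · rw [hf e fun w hw => hmem w hw fun h => hae (h ▸ hw), add_zero]

theorem IsCocycle.exists_coboundary_eq {x : P.Edge → ZMod 2} (hx : IsCocycle x) :
    ∃ f : P.Vertex → ZMod 2, coboundary f = x := by
  obtain ⟨η, hη⟩ := P.exists_injective_strongDual
  obtain ⟨f, hf⟩ := hx.exists_add_coboundary_eq_zero hη Finset.univ fun _ _ w _ =>
    Finset.mem_univ w
  exact ⟨f, funext fun e => (CharTwo.add_eq_zero.1 (hf e fun v _ => Finset.mem_univ v)).symm⟩

open Classical in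
theorem mem_code_iff {n : ℕ} (l : Fin n ≃ P.Edge) (c : Fin n → ZMod 2) :
    c ∈ P.code l ↔ ∀ v : P.Vertex, ∑ i with v.1 ⊆ (l i).1, c i = 0 :=
  Iff.rfl

open Classical in
theorem isCocycle_comp_symm_iff {n : ℕ} (l : Fin n ≃ P.Edge) (y : Fin n → ZMod 2) :
    IsCocycle (y ∘ l.symm) ↔ ∀ F : P.Facet, ∑ i with (l i).1 ⊆ F.1, y i = 0 := by
  refine forall_congr' fun F => ?_
  simp [Finset.sum_filter, ← Equiv.sum_comp l]

open Classical in
theorem indicator_facet_mem_code {n : ℕ} (l : Fin n ≃ P.Edge) (F : P.Facet) :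
    (fun i => if (l i).1 ⊆ F.1 then 1 else 0) ∈ P.code l := by
  intro v
  have h := sum_edges_at_eq_zero v F 1
  rw [Finset.sum_filter, ← Equiv.sum_comp l] at h
  rw [Finset.sum_filter, ← h]
  exact Finset.sum_congr rfl fun i _ => by split_ifs <;> tauto

theorem dotProduct_coboundary {n : ℕ} (l : Fin n ≃ P.Edge) {c : Fin n → ZMod 2}
    (hc : c ∈ P.code l) (f : P.Vertex → ZMod 2) : c ⬝ᵥ (coboundary f ∘ l) = 0 := by
  classical
  calc c ⬝ᵥ (coboundary f ∘ l) = ∑ i, ∑ v : P.Vertex with v.1 ⊆ (l i).1, f v * c i :=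
        Finset.sum_congr rfl fun i _ => by
          rw [Function.comp_apply, coboundary, mul_comm, Finset.sum_mul]
    _ = ∑ v : P.Vertex, ∑ i with v.1 ⊆ (l i).1, f v * c i := Finset.sum_comm' fun i v => by simp
    _ = 0 := Finset.sum_eq_zero fun v _ => by
        rw [← Finset.mul_sum]
        exact mul_eq_zero_of_right _ (hc v)

open Classical in
theorem mem_dualCode_code_iff {n : ℕ} (l : Fin n ≃ P.Edge) (y : Fin n → ZMod 2) :
    y ∈ dualCode (P.code l) ↔ ∀ F : P.Facet, ∑ i with (l i).1 ⊆ F.1, y i = 0 := by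
  refine ⟨fun hy F => ?_, fun hy c hc => ?_⟩
  · simpa [dotProduct, Finset.sum_filter] using hy _ (indicator_facet_mem_code l F)
  · obtain ⟨f, hf⟩ := ((isCocycle_comp_symm_iff l y).2 hy).exists_coboundary_eq
    have hyf : y = coboundary f ∘ l := by simp [hf, Function.comp_assoc]
    exact hyf ▸ dotProduct_coboundary l hc f

end Codes

section Duality

variable {Q : ConvexPolyhedron}

/-- The edges `e` of `P` and `d` of `Q` correspond under the duality given by `φ` and `ψ`, which by
itself only relates vertices and facets. -/
structure IsDualEdge (φ : P.Vertex ≃ Q.Facet) (ψ : P.Facet ≃ Q.Vertex) (e : P.Edge) (d : Q.Edge) :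
    Prop where
  facet_iff : ∀ F : P.Facet, e.1 ⊆ F.1 ↔ (ψ F).1 ⊆ d.1
  vertex_iff : ∀ v : P.Vertex, v.1 ⊆ e.1 ↔ d.1 ⊆ (φ v).1

variable {φ : P.Vertex ≃ Q.Facet} {ψ : P.Facet ≃ Q.Vertex}

theorem exists_isDualEdge (h : ∀ (v : P.Vertex) (F : P.Facet), v.1 ⊆ F.1 ↔ (ψ F).1 ⊆ (φ v).1)
    (e : P.Edge) : ∃ d : Q.Edge, IsDualEdge φ ψ e d := by
  obtain ⟨v, w, hvw, hv⟩ := e.exists_vertices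
  obtain ⟨F, G, hFG, hF⟩ := e.exists_facets
  have hve := (hv v).2 (.inl rfl)
  have hwe := (hv w).2 (.inr rfl)
  have heF := (hF F).2 (.inl rfl)
  have heG := (hF G).2 (.inr rfl)
  have hmem : ∀ H : P.Facet, e.1 ⊆ H.1 → (ψ H).1 ⊆ (φ v).1 ∩ (φ w).1 := fun H heH =>
    Set.subset_inter ((h v H).1 (hve.trans heH)) ((h w H).1 (hwe.trans heH))
  obtain ⟨d, hd⟩ := exists_edge_eq_inter (φ.injective.ne hvw) (ψ.injective.ne hFG) (hmem F heF)
    (hmem G heG)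
  obtain ⟨a, b, -, ha⟩ := d.exists_vertices
  obtain ⟨A, B, -, hA⟩ := d.exists_facets
  have hFd := (ha (ψ F)).1 (hd ▸ hmem F heF)
  have hGd := (ha (ψ G)).1 (hd ▸ hmem G heG)
  have hvd := (hA (φ v)).1 (hd ▸ Set.inter_subset_left)
  have hwd := (hA (φ w)).1 (hd ▸ Set.inter_subset_right)
  refine ⟨d, fun H => ?_, fun u => ?_⟩
  · have := ψ.injective.ne hFG
    rw [hF, ha, ← ψ.injective.eq_iff, ← ψ.injective.eq_iff (a := H) (b := G)]
    grind
  · have := φ.injective.ne hvw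
    rw [hv, hA, ← φ.injective.eq_iff, ← φ.injective.eq_iff (a := u) (b := w)]
    grind

theorem IsDualEdge.symm {e : P.Edge} {d : Q.Edge} (h : IsDualEdge φ ψ e d) :
    IsDualEdge ψ.symm φ.symm d e where
  facet_iff A := by rw [h.vertex_iff, φ.apply_symm_apply]
  vertex_iff a := by rw [h.facet_iff, ψ.apply_symm_apply]

theorem IsDualEdge.eq_left {e e' : P.Edge} {d : Q.Edge} (h : IsDualEdge φ ψ e d)
    (h' : IsDualEdge φ ψ e' d) : e = e' :=
  Edge.ext_vertices fun v => (h.vertex_iff v).trans (h'.vertex_iff v).symm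

theorem exists_edge_equiv (h : ∀ (v : P.Vertex) (F : P.Facet), v.1 ⊆ F.1 ↔ (ψ F).1 ⊆ (φ v).1) :
    ∃ σ : P.Edge ≃ Q.Edge, ∀ e, IsDualEdge φ ψ e (σ e) := by
  choose σ hσ using exists_isDualEdge h
  have hsymm : ∀ (a : Q.Vertex) (A : Q.Facet), a.1 ⊆ A.1 ↔ (φ.symm A).1 ⊆ (ψ.symm a).1 :=
    fun a A => by rw [h, φ.apply_symm_apply, ψ.apply_symm_apply]
  choose τ hτ using exists_isDualEdge hsymm
  exact ⟨⟨σ, τ, fun e => (hτ (σ e)).symm.eq_left (hσ e),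
    fun d => (hσ (τ d)).symm.eq_left (hτ d)⟩, hσ⟩

end Duality

end ConvexPolyhedron

theorem mainTheorem8 (Γ Γ' : ConvexPolyhedron) (hdual : Γ.IsDual Γ') {n n' : ℕ}
    (l : Fin n ≃ Γ.Edge) (l' : Fin n' ≃ Γ'.Edge) :
    CodeIsomorphic (dualCode (Γ.code l)) (Γ'.code l') := by
  classical
  obtain ⟨φ, ψ, h⟩ := hdual
  obtain ⟨σ, hσ⟩ := ConvexPolyhedron.exists_edge_equiv h
  let relabel : Fin n ≃ Fin n' := (l.trans σ).trans l'.symm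
  refine ⟨relabel, fun x => ?_⟩
  rw [ConvexPolyhedron.mem_code_iff, ConvexPolyhedron.mem_dualCode_code_iff, ← ψ.forall_congr_right]
  refine forall_congr' fun F => ?_
  rw [Finset.sum_filter, Finset.sum_filter, ← Equiv.sum_comp relabel]
  simp [relabel, (hσ _).facet_iff]
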